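/- Let $M=\mathbb R^3_{x,y,z}$ be the Heisenberg group with product $$(x_1,y_1,z_1)\cdot(x_2,y_2,z_2)=\bigl(x_1+x_2,\;y_1+y_2,\;z_1+z_2+(x_1y_2-x_2y_1)/2\bigr)$$ and left-invariant frame $X_1=\partial_x-\frac y2\partial_z$, $X_2=\partial_y+\frac x2\partial_z$, $X_3=\partial_z$. Let $\varepsilon>0$ and consider the control system $$\dot q=u_1X_1(q)+u_2X_2(q)+\varepsilon u_3X_3(q),\qquad q\in M,\qquad u=(u_1,u_2,u_3)\in U=\Bigl\{u_1\ge\sqrt{u_2^2+u_3^2}\Bigr\},$$ with measurable bounded controls $u(\cdot)$ and Lipschitz trajectories $q(\cdot)$, the equation holding almost everywhere. For $q_1\in M$ let $\mathcal A_{q_1}$ (resp. $\mathcal A^-_{q_1}$) be the set of points attainable from $q_1$ along trajectories of this system for arbitrary nonnegative (resp. nonpositive) time, and let $\mathcal A=\mathcal A_{\mathrm{Id}}$, $\mathcal A^-=\mathcal A^-_{\mathrm{Id}}$, where $\mathrm{Id}=(0,0,0)$. Then: (1) $\mathcal A=D$, where $$D=\Bigl\{(x,y,z)\in M \;\Big|\;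 x\ge|y|,\ |z|\le\tfrac{\varepsilon^2}{2}(\sinh\tau+\tau),\ \tau=\operatorname{arcosh}\Bigl(\tfrac{x^2-y^2}{2\varepsilon^2}+1\Bigr)\Bigr\}.$$ (2) $$\mathcal A^-=\Bigl\{(x,y,z)\in M \;\Big|\; x\le-|y|,\ |z|\le\tfrac{\varepsilon^2}{2}(\sinh\tau+\tau),\ \tau=\operatorname{arcosh}\Bigl(\tfrac{x^2-y^2}{2\varepsilon^2}+1\Bigr)\Bigr\}.$$ (3) For every $q_1=(x_1,y_1,z_1)\in M$, with $\tau=\operatorname{arcosh}\Bigl(\tfrac{(x-x_1)^2-(y-y_1)^2}{2\varepsilon^2}+1\Bigr)$, $$\mathcal A_{q_1}=q_1\cdot\mathcal A=\Bigl\{(x,y,z)\in M \;\Big|\; x-x_1\ge|y-y_1|,\ \Bigl|z-z_1-\tfrac{x_1y-xy_1}{2}\Bigr|\le\tfrac{\varepsilon^2}{2}(\sinh\tau+\tau)\Bigr\},$$ $$\mathcal A^-_{q_1}=q_1\cdot\mathcal A^-=\Bigl\{(x,y,z)\in M \;\Big|\; x-x_1\le-|y-y_1|,\ \Bigl|z-z_1-\tfrac{x_1y-xy_1}{2}\Bigr|\le\tfrac{\varepsilon^2}{2}(\sinh\tau+\tau)\Bigr\}.$$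 -/

import Mathlib

/-- The Heisenberg group `M = ℝ³` with coordinates `(x, y, z)`. -/
@[ext]
structure Heis where
  x : ℝ
  y : ℝ
  z : ℝ

noncomputable section

namespace Heis

/-- Product rule of the Heisenberg group. -/
instance : Mul Heis :=
  ⟨fun p q => ⟨p.x + q.x, p.y + q.y, p.z + q.z + (p.x * q.y - q.x * p.y) / 2⟩⟩

instance : One Heis := ⟨⟨0, 0, 0⟩⟩

instance : Inv Heis := ⟨fun p => ⟨-p.x, -p.y, -p.z⟩⟩

@[simp] theorem mul_x (p q : Heis) : (p * q).x = p.x + q.x := rfl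
@[simp] theorem mul_y (p q : Heis) : (p * q).y = p.y + q.y := rfl
@[simp] theorem mul_z (p q : Heis) :
    (p * q).z = p.z + q.z + (p.x * q.y - q.x * p.y) / 2 := rfl
@[simp] theorem one_x : (1 : Heis).x = 0 := rfl
@[simp] theorem one_y : (1 : Heis).y = 0 := rfl
@[simp] theorem one_z : (1 : Heis).z = 0 := rfl
@[simp] theorem inv_x (p : Heis) : (p⁻¹).x = -p.x := rfl
@[simp] theorem inv_y (p : Heis) : (p⁻¹).y = -p.y := rfl
@[simp] theorem inv_z (p : Heis) : (p⁻¹).z = -p.z := rfl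

instance : Group Heis :=
  Group.ofLeftAxioms
    (fun a b c => by ext <;> simp <;> ring)
    (fun a => by ext <;> simp)
    (fun a => by ext <;> simp [mul_comm])

/-- The global coordinates on `M`; tangent vectors are triples in these coordinates. -/
def coords (q : Heis) : ℝ × ℝ × ℝ := (q.x, q.y, q.z)

/-- `X₁ = ∂/∂x - (y/2) ∂/∂z`. -/
def X₁ (q : Heis) : ℝ × ℝ × ℝ := (1, 0, -(q.y / 2))

/-- `X₂ = ∂/∂y + (x/2) ∂/∂z`. -/
def X₂ (q : Heis) : ℝ × ℝ × ℝ := (0, 1, q.x / 2)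

/-- `X₃ = ∂/∂z`. -/
def X₃ (_q : Heis) : ℝ × ℝ × ℝ := (0, 0, 1)

/-- The set of control parameters `U = {u₁ ≥ √(u₂² + u₃²)}`. -/
def controlSet : Set (ℝ × ℝ × ℝ) :=
  {u | Real.sqrt (u.2.1 ^ 2 + u.2.2 ^ 2) ≤ u.1}

/-- `q` is a trajectory on `[a, b]` of the system `q' = u₁ X₁ + u₂ X₂ + ε u₃ X₃`, `u ∈ U`,
corresponding to the control `u`: the control is measurable and bounded on `[a, b]`,
the curve is Lipschitz on `[a, b]`, and the equation holds almost everywhere on `[a, b]`. -/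
structure IsTrajectory (ε a b : ℝ) (q : ℝ → Heis) (u : ℝ → ℝ × ℝ × ℝ) : Prop where
  measurable_control : Measurable u
  bounded_control : Bornology.IsBounded (u '' Set.Icc a b)
  control_mem : ∀ t ∈ Set.Icc a b, u t ∈ controlSet
  lipschitz : ∃ K : NNReal, LipschitzOnWith K (fun t => (q t).coords) (Set.Icc a b)
  hasDerivAt : ∀ᵐ t ∂MeasureTheory.volume.restrict (Set.Icc a b),
    HasDerivAt (fun s => (q s).coords)
      ((u t).1 • X₁ (q t) + (u t).2.1 • X₂ (q t) + (ε * (u t).2.2) • X₃ (q t)) t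

/-- The attainable set from `q₀` for arbitrary nonnegative time. -/
def attainable (ε : ℝ) (q₀ : Heis) : Set Heis :=
  {q₁ | ∃ t₁ : ℝ, 0 ≤ t₁ ∧ ∃ q u, IsTrajectory ε 0 t₁ q u ∧ q 0 = q₀ ∧ q t₁ = q₁}

/-- The attainable set from `q₀` for arbitrary nonpositive time. -/
def attainableNeg (ε : ℝ) (q₀ : Heis) : Set Heis :=
  {q₁ | ∃ t₁ : ℝ, t₁ ≤ 0 ∧ ∃ q u, IsTrajectory ε t₁ 0 q u ∧ q 0 = q₀ ∧ q t₁ = q₁}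

/-- `τ = arcosh ((x² - y²) / (2 ε²) + 1)`. -/
def tau (ε x y : ℝ) : ℝ := Real.arcosh ((x ^ 2 - y ^ 2) / (2 * ε ^ 2) + 1)

/-- `D = {x ≥ |y|, |z| ≤ (ε²/2) (sinh τ + τ)}` with `τ = arcosh ((x² - y²) / (2 ε²) + 1)`. -/
def domainD (ε : ℝ) : Set Heis :=
  {q | |q.y| ≤ q.x ∧ |q.z| ≤ ε ^ 2 / 2 * (Real.sinh (tau ε q.x q.y) + tau ε q.x q.y)}

end Heis

end

/-! Put `s = x² - y²` and let `B` be `heightBound`. For `σ = ±1` the barrier `B(s) - σ z` does not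
decrease along trajectories: this is the reversed Cauchy–Schwarz inequality for the timelike vector
`(x, y)` and the causal control `u` (`barrier_deriv_nonneg`). As `B'` blows up at `s = 0`, where
trajectories start, the barrier is first applied to a trajectory shifted into the open cone, and the
shift is then sent to zero; hence `attainable_one_subset`.

Conversely, lightlike controls tracing hyperbola arcs make the barrier estimate sharp. Lorentz
boosts of these arcs, flattened to lower the height, fill `D` over the open cone
(`mem_attainable_of_arc`); straight lines reach its edge. Left invariance and time reversal give the
other sets. -/

open MeasureTheory Set Filter Topology

/-! ### Monotonicity of absolutely continuous functions -/

namespace AbsolutelyContinuousOnInterval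

/-- The composition of a Lipschitz function with an absolutely continuous one is
absolutely continuous. -/
theorem lipschitzOnWith_comp {f g : ℝ → ℝ} {a b : ℝ} {K : NNReal} {s : Set ℝ}
    (hg : LipschitzOnWith K g s) (hf : AbsolutelyContinuousOnInterval f a b)
    (hs : MapsTo f (uIcc a b) s) : AbsolutelyContinuousOnInterval (fun t => g (f t)) a b := by
  rw [absolutelyContinuousOnInterval_iff] at hf ⊢
  intro r hr
  obtain ⟨δ, hδ, h⟩ := hf (r / (K + 1)) (by positivity)
  refine ⟨δ, hδ, fun E hE hEδ => ?_⟩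
  calc
    _ ≤ ∑ i ∈ Finset.range E.1, K * dist (f (E.2 i).1) (f (E.2 i).2) :=
        Finset.sum_le_sum fun i hi =>
          hg.dist_le_mul _ (hs (hE.1 i hi).1) _ (hs (hE.1 i hi).2)
    _ = K * ∑ i ∈ Finset.range E.1, dist (f (E.2 i).1) (f (E.2 i).2) := by
        rw [Finset.mul_sum]
    _ ≤ K * (r / (K + 1)) := by gcongr; exact (h E hE hEδ).le
    _ < (K + 1) * (r / (K + 1)) := by gcongr; exact lt_add_one _
    _ = r := by field_simp

/-- An absolutely continuous function whose derivative is nonnegative almost everywhere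
does not decrease. -/
theorem le_of_ae_deriv_nonneg {f : ℝ → ℝ} {a b : ℝ} (hab : a ≤ b)
    (hf : AbsolutelyContinuousOnInterval f a b)
    (h : ∀ᵐ t ∂volume.restrict (Icc a b), 0 ≤ deriv f t) : f a ≤ f b := by
  have h1 := hf.integral_deriv_eq_sub
  have h2 : 0 ≤ ∫ t in a..b, deriv f t :=
    intervalIntegral.integral_nonneg_of_ae_restrict hab h
  linarith

end AbsolutelyContinuousOnInterval

namespace Heis

/-! ### The height function and the infinitesimal barrier inequality -/

/-- The half-height of the domain `D` as a function of `s = x² - y²`. -/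
noncomputable def heightBound (ε s : ℝ) : ℝ :=
  ε ^ 2 / 2 * (Real.sinh (Real.arcosh (s / (2 * ε ^ 2) + 1)) + Real.arcosh (s / (2 * ε ^ 2) + 1))

theorem heightBound_nonneg (ε : ℝ) {s : ℝ} (hs : 0 ≤ s) : 0 ≤ heightBound ε s := by
  have h : 0 ≤ Real.arcosh (s / (2 * ε ^ 2) + 1) :=
    Real.arcosh_nonneg (by have : 0 ≤ s / (2 * ε ^ 2) := by positivity
                           linarith)
  have := Real.sinh_nonneg_iff.2 h
  unfold heightBound
  positivity

theorem continuousOn_heightBound (ε : ℝ) : ContinuousOn (heightBound ε) (Ici 0) := by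
  have h : ContinuousOn (fun s => Real.arcosh (s / (2 * ε ^ 2) + 1)) (Ici 0) := by
    refine Real.continuousOn_arcosh.comp (by fun_prop) fun s hs => ?_
    have : 0 ≤ s / (2 * ε ^ 2) := div_nonneg hs (by positivity)
    simpa using this
  exact continuousOn_const.mul ((Real.continuous_sinh.comp_continuousOn h).add h)

theorem contDiffOn_heightBound {ε : ℝ} (hε : 0 < ε) :
    ContDiffOn ℝ 1 (heightBound ε) (Ioi 0) := by
  have h : ContDiffOn ℝ 1 (fun s => Real.arcosh (s / (2 * ε ^ 2) + 1)) (Ioi 0) := by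
    refine Real.contDiffOn_arcosh.comp (by fun_prop) fun s hs => ?_
    have : 0 < s / (2 * ε ^ 2) := div_pos hs (by positivity)
    simpa using this
  exact contDiffOn_const.mul ((Real.contDiff_sinh.comp_contDiffOn h).add h)

/-- The half-angle parametrization `s = 4 ε² S²`, `S = sinh (τ / 2)`, `c = cosh (τ / 2)`, and the
derivative of `heightBound` in terms of it. -/
theorem exists_hasDerivAt_heightBound {ε s : ℝ} (hε : 0 < ε) (hs : 0 < s) :
    ∃ c S : ℝ, 0 < c ∧ 0 < S ∧ c ^ 2 = S ^ 2 + 1 ∧ s = 4 * ε ^ 2 * S ^ 2 ∧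
      HasDerivAt (heightBound ε) (c / (4 * S)) s := by
  have hw : 1 < s / (2 * ε ^ 2) + 1 := by
    have : 0 < s / (2 * ε ^ 2) := by positivity
    linarith
  obtain ⟨r, hr⟩ : ∃ r, Real.arcosh (s / (2 * ε ^ 2) + 1) = 2 * r :=
    ⟨Real.arcosh (s / (2 * ε ^ 2) + 1) / 2, by ring⟩
  have hr0 : 0 < r := by linarith [Real.arcosh_pos hw]
  have hS : 0 < Real.sinh r := Real.sinh_pos_iff.2 hr0
  have hc : 0 < Real.cosh r := Real.cosh_pos r
  have hcosh := Real.cosh_arcosh hw.le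
  have hsinh := Real.sinh_arcosh hw.le
  rw [hr, Real.cosh_two_mul] at hcosh
  rw [hr, Real.sinh_two_mul] at hsinh
  have hsq := Real.cosh_sq r
  have hd : HasDerivAt (fun s => Real.arcosh (s / (2 * ε ^ 2) + 1))
      ((2 * Real.sinh r * Real.cosh r)⁻¹ * (1 / (2 * ε ^ 2))) s := by
    rw [hsinh]
    have hi : HasDerivAt (fun s => s / (2 * ε ^ 2) + 1) (1 / (2 * ε ^ 2)) s :=
      ((hasDerivAt_id' s).div_const _).add_const 1
    exact HasDerivAt.comp (h₂ := Real.arcosh) s (Real.hasDerivAt_arcosh hw) hi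
  refine ⟨Real.cosh r, Real.sinh r, hc, hS, hsq, ?_, ?_⟩
  · field_simp at hcosh
    nlinarith
  · have := (hd.sinh.add hd).const_mul (ε ^ 2 / 2)
    rw [hr, Real.cosh_two_mul] at this
    have e : Real.cosh r / (4 * Real.sinh r) = ε ^ 2 / 2 *
        ((Real.cosh r ^ 2 + Real.sinh r ^ 2) *
            ((2 * Real.sinh r * Real.cosh r)⁻¹ * (1 / (2 * ε ^ 2))) +
          (2 * Real.sinh r * Real.cosh r)⁻¹ * (1 / (2 * ε ^ 2))) := by
      field_simp
      linarith
    rw [e]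
    exact this

/-- Reversed Cauchy–Schwarz inequality in Minkowski space `ℝ^{1,2}`, in the form needed for the
monotonicity of the barrier function along trajectories. -/
theorem barrier_deriv_nonneg {ε x y u₁ u₂ u₃ c S σ : ℝ} (hε : 0 < ε)
    (hu : Real.sqrt (u₂ ^ 2 + u₃ ^ 2) ≤ u₁) (hxy : |y| ≤ x) (hc : 0 < c) (hS : 0 < S)
    (hcS : c ^ 2 = S ^ 2 + 1) (hs : x ^ 2 - y ^ 2 = 4 * ε ^ 2 * S ^ 2) (hσ : σ ^ 2 = 1) :
    0 ≤ c / (4 * S) * (2 * (x * u₁ - y * u₂)) - σ * ((x * u₂ - y * u₁) / 2 + ε * u₃) := by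
  obtain ⟨hu0, hu2⟩ := Real.sqrt_le_iff.1 hu
  have hP : 0 ≤ x * u₁ - y * u₂ := by
    have h2 : |u₂| ≤ u₁ := abs_le_of_sq_le_sq (by nlinarith [sq_nonneg u₃]) hu0
    have h3 : |y * u₂| ≤ x * u₁ := by
      rw [abs_mul]; exact mul_le_mul hxy h2 (abs_nonneg _) ((abs_nonneg _).trans hxy)
    linarith [le_abs_self (y * u₂)]
  -- Uses `P² - Q² = (x² - y²)(u₁² - u₂²)`, with `P`, `Q` the Minkowski product and the determinant
  -- of `(x, y)` and `(u₁, u₂)`.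
  have hPQ : (x * u₂ - y * u₁) ^ 2 + (2 * ε * S * u₃) ^ 2 ≤ (x * u₁ - y * u₂) ^ 2 := by
    have : 0 ≤ (x ^ 2 - y ^ 2) * (u₁ ^ 2 - (u₂ ^ 2 + u₃ ^ 2)) :=
      mul_nonneg (by rw [hs]; positivity) (by linarith)
    have h4 : (2 * ε * S * u₃) ^ 2 = (x ^ 2 - y ^ 2) * u₃ ^ 2 := by rw [hs]; ring
    rw [h4]; linarith
  set P := x * u₁ - y * u₂
  set Q := x * u₂ - y * u₁
  -- Euclidean Cauchy–Schwarz for `(S, 1)` and `(Q, 2εSu₃)`; the first vector has length `c`.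
  have key : σ * (S * Q + 2 * ε * S * u₃) ≤ c * P := by
    refine le_of_sq_le_sq ?_ (by positivity)
    calc (σ * (S * Q + 2 * ε * S * u₃)) ^ 2 = (S * Q + 2 * ε * S * u₃) ^ 2 := by
          rw [mul_pow, hσ, one_mul]
      _ ≤ (S ^ 2 + 1) * (Q ^ 2 + (2 * ε * S * u₃) ^ 2) := by
          nlinarith [sq_nonneg (S * (2 * ε * S * u₃) - Q)]
      _ ≤ (S ^ 2 + 1) * P ^ 2 := by gcongr
      _ = (c * P) ^ 2 := by rw [← hcS]; ring
  have : c / (4 * S) * (2 * P) - σ * (Q / 2 + ε * u₃) =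
      (c * P - σ * (S * Q + 2 * ε * S * u₃)) / (2 * S) := by
    field_simp; ring
  rw [this]
  exact div_nonneg (by linarith) (by positivity)

/-! ### Trajectories in coordinates -/

namespace IsTrajectory

variable {ε a b : ℝ} {q : ℝ → Heis} {u : ℝ → ℝ × ℝ × ℝ}

theorem absolutelyContinuous_coords (h : IsTrajectory ε a b q u) (hab : a ≤ b) :
    AbsolutelyContinuousOnInterval (fun t => (q t).x) a b ∧
    AbsolutelyContinuousOnInterval (fun t => (q t).y) a b ∧
    AbsolutelyContinuousOnInterval (fun t => (q t).z) a b := by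
  obtain ⟨K, hK⟩ := h.lipschitz
  rw [← uIcc_of_le hab] at hK
  have h1 := LipschitzWith.prod_fst.comp_lipschitzOnWith hK
  have h2 := LipschitzWith.prod_snd.comp_lipschitzOnWith hK
  exact ⟨h1.absolutelyContinuousOnInterval,
    (LipschitzWith.prod_fst.comp_lipschitzOnWith h2).absolutelyContinuousOnInterval,
    (LipschitzWith.prod_snd.comp_lipschitzOnWith h2).absolutelyContinuousOnInterval⟩

end IsTrajectory

theorem hasDerivAt_coords_iff {q : ℝ → Heis} {v : ℝ × ℝ × ℝ} {t : ℝ} :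
    HasDerivAt (fun s => (q s).coords) v t ↔
      HasDerivAt (fun s => (q s).x) v.1 t ∧ HasDerivAt (fun s => (q s).y) v.2.1 t ∧
        HasDerivAt (fun s => (q s).z) v.2.2 t := by
  refine ⟨fun h => ?_, fun ⟨h1, h2, h3⟩ => h1.prodMk (h2.prodMk h3)⟩
  have h1 := (h.hasFDerivAt.fst).hasDerivAt
  have h2 := h.hasFDerivAt.snd
  have h3 := h2.fst.hasDerivAt
  have h4 := h2.snd.hasDerivAt
  simp only [ContinuousLinearMap.comp_apply, ContinuousLinearMap.toSpanSingleton_apply,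
    ContinuousLinearMap.coe_fst', ContinuousLinearMap.coe_snd', one_smul] at h1 h3 h4
  exact ⟨h1, h3, h4⟩

/-- The velocity field of the control system in coordinates. -/
theorem velocity_eq (ε : ℝ) (p : Heis) (v : ℝ × ℝ × ℝ) :
    v.1 • X₁ p + v.2.1 • X₂ p + (ε * v.2.2) • X₃ p =
      (v.1, v.2.1, (p.x * v.2.1 - p.y * v.1) / 2 + ε * v.2.2) := by
  ext <;> simp [X₁, X₂, X₃]
  ring

/-! ### The attainable set lies in `D` -/

namespace IsTrajectory

variable {ε a b : ℝ} {q : ℝ → Heis} {u : ℝ → ℝ × ℝ × ℝ}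

theorem ae_hasDerivAt (h : IsTrajectory ε a b q u) :
    ∀ᵐ t ∂volume.restrict (Icc a b),
      Real.sqrt ((u t).2.1 ^ 2 + (u t).2.2 ^ 2) ≤ (u t).1 ∧
      HasDerivAt (fun s => (q s).x) (u t).1 t ∧ HasDerivAt (fun s => (q s).y) (u t).2.1 t ∧
        HasDerivAt (fun s => (q s).z)
          (((q t).x * (u t).2.1 - (q t).y * (u t).1) / 2 + ε * (u t).2.2) t := by
  filter_upwards [h.hasDerivAt, ae_restrict_mem measurableSet_Icc] with t ht hmem
  rw [velocity_eq, hasDerivAt_coords_iff] at ht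
  exact ⟨h.control_mem t hmem, ht⟩

theorem mono (h : IsTrajectory ε a b q u) {c d : ℝ} (hcd : Icc c d ⊆ Icc a b) :
    IsTrajectory ε c d q u where
  measurable_control := h.measurable_control
  bounded_control := h.bounded_control.subset (image_mono hcd)
  control_mem t ht := h.control_mem t (hcd ht)
  lipschitz := h.lipschitz.imp fun _ hK => hK.mono hcd
  hasDerivAt := ae_restrict_of_ae_restrict_of_subset hcd h.hasDerivAt

theorem abs_sub_y_le (h : IsTrajectory ε a b q u) (hab : a ≤ b) :
    |(q b).y - (q a).y| ≤ (q b).x - (q a).x := by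
  obtain ⟨hx, hy, -⟩ := h.absolutelyContinuous_coords hab
  have hu : ∀ {v : ℝ × ℝ × ℝ}, Real.sqrt (v.2.1 ^ 2 + v.2.2 ^ 2) ≤ v.1 → |v.2.1| ≤ v.1 :=
    fun hv => (Real.abs_le_sqrt (by nlinarith)).trans hv
  -- Both `x - y` and `x + y` are nondecreasing, since `|u₂| ≤ u₁`.
  have h1 := (hx.fun_sub hy).le_of_ae_deriv_nonneg hab (by
    filter_upwards [h.ae_hasDerivAt] with t ⟨hut, h1, h2, _⟩
    rw [(h1.fun_sub h2).deriv]
    linarith [le_abs_self (u t).2.1, hu hut])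
  have h2 := (hx.fun_add hy).le_of_ae_deriv_nonneg hab (by
    filter_upwards [h.ae_hasDerivAt] with t ⟨hut, h1, h2, _⟩
    rw [(h1.fun_add h2).deriv]
    linarith [neg_abs_le (u t).2.1, hu hut])
  rw [abs_le]
  constructor <;> linarith

/-- Left translation by `(δ, 0, 0)` sends `(x, y, z)` to `(x + δ, y, z + δ y / 2)` and preserves the
system. The translated curve keeps `s ≥ δ²`, away from the singularity of `B'`, and its barrier
starts at `B(δ²) ≥ 0`. -/
theorem barrier_le (h : IsTrajectory ε 0 b q u) (hε : 0 < ε) (hb : 0 ≤ b) (h0 : q 0 = 1)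
    {δ : ℝ} (hδ : 0 < δ) {σ : ℝ} (hσ : σ ^ 2 = 1) :
    σ * ((q b).z + δ * (q b).y / 2) ≤ heightBound ε (((q b).x + δ) ^ 2 - (q b).y ^ 2) := by
  obtain ⟨hx, hy, hz⟩ := h.absolutelyContinuous_coords hb
  have hcone : ∀ t ∈ Icc 0 b, |(q t).y| ≤ (q t).x := fun t ht => by
    simpa [h0] using (h.mono (Icc_subset_Icc_right ht.2)).abs_sub_y_le ht.1
  have hpos : ∀ t ∈ Icc 0 b, δ ^ 2 ≤ ((q t).x + δ) ^ 2 - (q t).y ^ 2 := fun t ht => by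
    have h1 := hcone t ht
    have h2 := (abs_nonneg _).trans h1
    have h3 := sq_le_sq' (abs_le.1 h1).1 (abs_le.1 h1).2
    nlinarith
  have hX : AbsolutelyContinuousOnInterval (fun t => (q t).x + δ) 0 b :=
    hx.fun_add (LipschitzWith.const δ).lipschitzOnWith.absolutelyContinuousOnInterval
  have hs : AbsolutelyContinuousOnInterval
      (fun t => ((q t).x + δ) ^ 2 - (q t).y ^ 2) 0 b := by
    simpa only [sq] using (hX.fun_mul hX).fun_sub (hy.fun_mul hy)
  obtain ⟨C, hC⟩ := hs.exists_bound
  rw [uIcc_of_le hb] at hC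
  -- On the compact interval `[δ², C]` the function `B` is Lipschitz, so its composition with `s`
  -- stays absolutely continuous.
  obtain ⟨K, hK⟩ := ((contDiffOn_heightBound hε).mono
    fun s hs => (pow_pos hδ 2).trans_le hs.1).exists_lipschitzOnWith one_ne_zero (convex_Icc _ _) isCompact_Icc
  have hB := AbsolutelyContinuousOnInterval.lipschitzOnWith_comp hK hs (by
    rw [uIcc_of_le hb]
    exact fun t ht => ⟨hpos t ht, (le_abs_self _).trans (hC t ht)⟩)
  have hmono := (hB.fun_sub ((hz.fun_add (hy.const_mul (δ / 2))).const_mul σ)).le_of_ae_deriv_nonneg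
    hb (by
      filter_upwards [h.ae_hasDerivAt, ae_restrict_mem measurableSet_Icc]
        with t ⟨hut, h1, h2, h3⟩ ht
      have hst := (pow_pos hδ 2).trans_le (hpos t ht)
      obtain ⟨c, S, hc, hS, hcS, hsS, hd⟩ := exists_hasDerivAt_heightBound hε hst
      have hin := ((h1.add_const δ).fun_pow 2).fun_sub (h2.fun_pow 2)
      have hf := (hd.comp t hin).fun_sub ((h3.fun_add (h2.const_mul (δ / 2))).const_mul σ)
      have hcone' : |(q t).y| ≤ (q t).x + δ := (hcone t ht).trans (by linarith)
      refine (barrier_deriv_nonneg hε hut hcone' hc hS hcS hsS hσ).trans_eq ?_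
      refine Eq.trans ?_ hf.deriv.symm
      push_cast
      ring)
  have := heightBound_nonneg ε (sq_nonneg δ)
  simp only [h0, one_x, one_y, one_z] at hmono
  norm_num at hmono
  linarith

end IsTrajectory

theorem attainable_one_subset {ε : ℝ} (hε : 0 < ε) : attainable ε 1 ⊆ domainD ε := by
  rintro _ ⟨b, hb, q, u, h, h0, rfl⟩
  have hcone : |(q b).y| ≤ (q b).x := by simpa [h0] using h.abs_sub_y_le hb
  refine ⟨hcone, ?_⟩
  change _ ≤ heightBound ε ((q b).x ^ 2 - (q b).y ^ 2)
  have hx0 : 0 ≤ (q b).x := (abs_nonneg _).trans hcone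
  have hsq : (q b).y ^ 2 ≤ (q b).x ^ 2 := sq_le_sq.2 (by rwa [abs_of_nonneg hx0])
  have hlim : Tendsto (fun δ => heightBound ε (((q b).x + δ) ^ 2 - (q b).y ^ 2)) (𝓝[>] 0)
      (𝓝 (heightBound ε ((q b).x ^ 2 - (q b).y ^ 2))) := by
    refine (continuousOn_heightBound ε _ (sub_nonneg.2 hsq)).tendsto.comp
      (tendsto_nhdsWithin_iff.2 ⟨?_, ?_⟩)
    · have : Continuous fun δ : ℝ => ((q b).x + δ) ^ 2 - (q b).y ^ 2 := by fun_prop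
      simpa using (this.tendsto 0).mono_left nhdsWithin_le_nhds
    · filter_upwards [self_mem_nhdsWithin] with δ hδ
      have : 0 < δ := hδ
      exact sub_nonneg.2 (hsq.trans (by gcongr; linarith))
  have hside : ∀ σ : ℝ, σ ^ 2 = 1 →
      σ * (q b).z ≤ heightBound ε ((q b).x ^ 2 - (q b).y ^ 2) := fun σ hσ => by
    refine le_of_tendsto_of_tendsto (f := fun δ => σ * ((q b).z + δ * (q b).y / 2)) ?_ hlim ?_
    · have : Continuous fun δ : ℝ => σ * ((q b).z + δ * (q b).y / 2) := by fun_prop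
      simpa using (this.tendsto 0).mono_left nhdsWithin_le_nhds
    · filter_upwards [self_mem_nhdsWithin] with δ hδ
      exact h.barrier_le hε hb h0 hδ hσ
  exact abs_le'.2 ⟨by simpa using hside 1 (by norm_num), by simpa using hside (-1) (by norm_num)⟩

/-! ### Explicit trajectories filling `D` -/

/-- A `C¹` curve that satisfies the control system everywhere with a continuous control is a
trajectory. -/
theorem isTrajectory_of_contDiff {ε a b : ℝ} {q : ℝ → Heis} {u : ℝ → ℝ × ℝ × ℝ}
    (hq : ContDiff ℝ 1 fun t => (q t).coords) (hu : Continuous u) (hU : ∀ t, u t ∈ controlSet)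
    (hd : ∀ t, HasDerivAt (fun s => (q s).coords)
      ((u t).1 • X₁ (q t) + (u t).2.1 • X₂ (q t) + (ε * (u t).2.2) • X₃ (q t)) t) :
    IsTrajectory ε a b q u where
  measurable_control := hu.measurable
  bounded_control := (isCompact_Icc.image hu).isBounded
  control_mem t _ := hU t
  lipschitz := hq.contDiffOn.exists_lipschitzOnWith one_ne_zero (convex_Icc _ _) isCompact_Icc
  hasDerivAt := .of_forall hd

theorem mem_attainable_of_z_eq_zero {ε : ℝ} {p : Heis} (hp : |p.y| ≤ p.x) (hz : p.z = 0) : p ∈ attainable ε 1 := by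
  refine ⟨1, zero_le_one, fun t => ⟨t * p.x, t * p.y, 0⟩, fun _ => (p.x, p.y, 0),
    isTrajectory_of_contDiff ?_ continuous_const ?_ ?_, ?_, ?_⟩
  · unfold coords; fun_prop
  · intro _
    simpa [controlSet, Real.sqrt_sq_eq_abs] using hp
  · intro t
    rw [velocity_eq, hasDerivAt_coords_iff]
    refine ⟨by simpa using (hasDerivAt_id' t).mul_const p.x,
      by simpa using (hasDerivAt_id' t).mul_const p.y, ?_⟩
    have : ((t * p.x) * p.y - (t * p.y) * p.x) / 2 + ε * 0 = 0 := by ring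
    exact (hasDerivAt_const t (0 : ℝ)).congr_deriv this.symm
  · ext <;> simp
  · ext <;> simp [hz]

/-- Points above the interior of the cone are reached along boosted arcs of hyperbolas,
flattened by a factor `l`. -/
theorem mem_attainable_of_arc {ε κ η l τ : ℝ} (hε : 0 < ε) (hκ : |η| ≤ κ)
    (hκη : κ ^ 2 - η ^ 2 = 1) (hl : |l| ≤ 1) (hτ : 0 ≤ τ) :
    (⟨κ * (2 * ε * Real.sinh (τ / 2)), η * (2 * ε * Real.sinh (τ / 2)),
      l * (ε ^ 2 / 2 * (Real.sinh τ + τ))⟩ : Heis) ∈ attainable ε 1 := by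
  set α := τ / 2 with hα
  -- Centring the arc at `α = τ / 2` makes `Y` vanish at both ends, so the endpoint before boosting
  -- is `(2ε sinh α, 0)`.
  let X : ℝ → ℝ := fun t => ε * (Real.sinh (t - α) + Real.sinh α)
  let Y : ℝ → ℝ := fun t => l * ε * (Real.cosh (t - α) - Real.cosh α)
  have hX : ∀ t, HasDerivAt X (ε * Real.cosh (t - α)) t := fun t => by
    simpa using ((((hasDerivAt_id' t).sub_const α).sinh).add_const (Real.sinh α)).const_mul ε
  have hY : ∀ t, HasDerivAt Y (l * ε * Real.sinh (t - α)) t := fun t => by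
    simpa using
      ((((hasDerivAt_id' t).sub_const α).cosh).sub_const (Real.cosh α)).const_mul (l * ε)
  have hl2 : l ^ 2 ≤ 1 := (sq_le_one_iff_abs_le_one l).2 hl
  refine ⟨τ, hτ, fun t => ⟨κ * X t + η * Y t, η * X t + κ * Y t,
      l * (ε ^ 2 / 2 * (Real.sinh t + t))⟩,
    fun t => (κ * (ε * Real.cosh (t - α)) + η * (l * ε * Real.sinh (t - α)),
      η * (ε * Real.cosh (t - α)) + κ * (l * ε * Real.sinh (t - α)), l * ε),
    isTrajectory_of_contDiff ?_ ?_ ?_ ?_, ?_, ?_⟩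
  · have hsinh := Real.contDiff_sinh (n := 1)
    have hcosh := Real.contDiff_cosh (n := 1)
    unfold coords
    simp only [X, Y]
    fun_prop
  · fun_prop
  · intro t
    change Real.sqrt _ ≤ _
    have hc := Real.cosh_sq (t - α)
    have hcs : |Real.sinh (t - α)| ≤ Real.cosh (t - α) :=
      abs_le_of_sq_le_sq (by linarith) (Real.cosh_pos _).le
    set c := Real.cosh (t - α)
    set s := Real.sinh (t - α)
    have hls : |l * s| ≤ c := by
      rw [abs_mul]
      exact (mul_le_of_le_one_left (abs_nonneg _) hl).trans hcs
    have h1 : |η * (l * s)| ≤ κ * c := by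
      rw [abs_mul]
      exact mul_le_mul hκ hls (abs_nonneg _) ((abs_nonneg _).trans hκ)
    refine Real.sqrt_le_iff.2 ⟨?_, ?_⟩
    · have : κ * (ε * c) + η * (l * ε * s) = ε * (κ * c + η * (l * s)) := by ring
      rw [this]
      exact mul_nonneg hε.le (by linarith [neg_abs_le (η * (l * s))])
    -- The boost preserves the Minkowski form, whose value on the control is `ε² (1 - l²) cosh² (t -
    -- α)`: lightlike exactly when `|l| = 1`.
    · have : (κ * (ε * c) + η * (l * ε * s)) ^ 2 - ((η * (ε * c) + κ * (l * ε * s)) ^ 2 +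
          (l * ε) ^ 2) = ε ^ 2 * ((κ ^ 2 - η ^ 2) * (c ^ 2 - l ^ 2 * s ^ 2) - l ^ 2) := by ring
      have h2 : 0 ≤ ε ^ 2 * ((κ ^ 2 - η ^ 2) * (c ^ 2 - l ^ 2 * s ^ 2) - l ^ 2) := by
        rw [hκη, hc]
        have : 0 ≤ (1 - l ^ 2) * (s ^ 2 + 1) := mul_nonneg (by linarith) (by positivity)
        exact mul_nonneg (by positivity) (by linarith)
      linarith
  · intro t
    rw [velocity_eq, hasDerivAt_coords_iff]
    refine ⟨((hX t).const_mul κ).fun_add ((hY t).const_mul η),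
      ((hX t).const_mul η).fun_add ((hY t).const_mul κ), ?_⟩
    have hz := (((Real.hasDerivAt_sinh t).fun_add (hasDerivAt_id' t)).const_mul
      (ε ^ 2 / 2)).const_mul l
    have ht : Real.cosh t = Real.cosh (t - α) * Real.cosh α + Real.sinh (t - α) * Real.sinh α := by
      rw [← Real.cosh_add, sub_add_cancel]
    have hc := Real.cosh_sq (t - α)
    refine hz.congr_deriv ?_
    simp only [X, Y]
    rw [ht]
    linear_combination (l * ε ^ 2 / 2) * hc + (-(l * ε ^ 2 / 2) *
      (Real.cosh (t - α) * Real.cosh α + Real.sinh (t - α) * Real.sinh α -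
        Real.cosh (t - α) ^ 2 + Real.sinh (t - α) ^ 2)) * hκη
  · ext <;> simp [X, Y]
  · have : τ - α = α := by rw [hα]; ring
    ext <;> simp only [X, Y, this] <;> ring

theorem domainD_subset {ε : ℝ} (hε : 0 < ε) : domainD ε ⊆ attainable ε 1 := by
  rintro p ⟨hcone, hz⟩
  have hx0 : 0 ≤ p.x := (abs_nonneg _).trans hcone
  have hsq : p.y ^ 2 ≤ p.x ^ 2 := sq_le_sq.2 (by rwa [abs_of_nonneg hx0])
  rcases hsq.eq_or_lt with h | h
  · refine mem_attainable_of_z_eq_zero hcone ?_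
    simpa [tau, h] using hz
  · have hw : 1 < (p.x ^ 2 - p.y ^ 2) / (2 * ε ^ 2) + 1 := by
      have : 0 < (p.x ^ 2 - p.y ^ 2) / (2 * ε ^ 2) := div_pos (by linarith) (by positivity)
      linarith
    have hτ : 0 < tau ε p.x p.y := Real.arcosh_pos hw
    have hcosh : Real.cosh (tau ε p.x p.y) = _ := Real.cosh_arcosh hw.le
    set τ := tau ε p.x p.y
    have hB : 0 < ε ^ 2 / 2 * (Real.sinh τ + τ) := by
      have := Real.sinh_pos_iff.2 hτ
      positivity
    have hρ : 0 < 2 * ε * Real.sinh (τ / 2) := by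
      have := Real.sinh_pos_iff.2 (half_pos hτ)
      positivity
    have hρ2 : p.x ^ 2 - p.y ^ 2 = (2 * ε * Real.sinh (τ / 2)) ^ 2 := by
      have h2 := Real.cosh_two_mul (τ / 2)
      rw [mul_div_cancel₀ τ two_ne_zero, hcosh, Real.cosh_sq] at h2
      have h3 : (p.x ^ 2 - p.y ^ 2) / (2 * ε ^ 2) = 2 * Real.sinh (τ / 2) ^ 2 := by linarith
      rw [div_eq_iff (by positivity)] at h3
      linarith
    -- `(κ, η)` is `(x, y)` normalized to Minkowski length one; `l` is the ratio of `z` to the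
    -- maximal height.
    have key := mem_attainable_of_arc (κ := p.x / (2 * ε * Real.sinh (τ / 2)))
      (η := p.y / (2 * ε * Real.sinh (τ / 2))) (l := p.z / (ε ^ 2 / 2 * (Real.sinh τ + τ))) hε
      (by rw [abs_div, abs_of_pos hρ]; gcongr)
      (by rw [div_pow, div_pow, ← sub_div, hρ2]; exact div_self (by positivity))
      (by rw [abs_div, abs_of_pos hB]; exact (div_le_one hB).2 hz) hτ.le
    rwa [div_mul_cancel₀ _ hρ.ne', div_mul_cancel₀ _ hρ.ne', div_mul_cancel₀ _ hB.ne'] at key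

/-! ### Time shifts, left translations and time reversal -/

namespace IsTrajectory

variable {ε a b : ℝ} {q : ℝ → Heis} {u : ℝ → ℝ × ℝ × ℝ}

theorem comp_sub_const (h : IsTrajectory ε a b q u) (c : ℝ) :
    IsTrajectory ε (a + c) (b + c) (fun t => q (t - c)) (fun t => u (t - c)) := by
  have hmaps : MapsTo (fun t => t - c) (Icc (a + c) (b + c)) (Icc a b) := fun t ht =>
    ⟨by linarith [ht.1], by linarith [ht.2]⟩
  refine ⟨h.measurable_control.comp (measurable_id.sub_const c), h.bounded_control.subset ?_,
    fun t ht => h.control_mem _ (hmaps ht), ?_, ?_⟩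
  · rintro _ ⟨t, ht, rfl⟩
    exact ⟨t - c, hmaps ht, rfl⟩
  · obtain ⟨K, hK⟩ := h.lipschitz
    refine ⟨K, fun s hs t ht => ?_⟩
    simpa [edist_dist] using hK (hmaps hs) (hmaps ht)
  · have hd := (ae_restrict_iff' measurableSet_Icc).1 h.hasDerivAt
    rw [ae_restrict_iff' measurableSet_Icc]
    filter_upwards [(measurePreserving_sub_right volume c).quasiMeasurePreserving.ae hd] with t ht
    exact fun hmem => (ht (hmaps hmem)).comp_sub_const t c

theorem mul_left (h : IsTrajectory ε a b q u) (g : Heis) :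
    IsTrajectory ε a b (fun t => g * q t) u := by
  refine ⟨h.measurable_control, h.bounded_control, h.control_mem, ?_, ?_⟩
  · obtain ⟨K, hK⟩ := h.lipschitz
    let G : ℝ × ℝ × ℝ → ℝ × ℝ × ℝ := fun v =>
      (g.x + v.1, g.y + v.2.1, g.z + v.2.2 + (g.x * v.2.1 - v.1 * g.y) / 2)
    have hG : ContDiff ℝ 1 G := by fun_prop
    obtain ⟨C, hC⟩ := hG.locallyLipschitz.locallyLipschitzOn.exists_lipschitzOnWith_of_compact
      (isCompact_Icc.image_of_continuousOn hK.continuousOn)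
    exact ⟨C * K, hC.comp hK (mapsTo_image _ _)⟩
  · filter_upwards [h.hasDerivAt] with t ht
    rw [velocity_eq, hasDerivAt_coords_iff] at ht ⊢
    obtain ⟨h1, h2, h3⟩ := ht
    refine ⟨h1.const_add g.x, h2.const_add g.y, ?_⟩
    refine ((h3.const_add g.z).fun_add
      (((h2.const_mul g.x).fun_sub (h1.mul_const g.y)).div_const 2)).congr_deriv ?_
    simp only [mul_x, mul_y]
    ring

end IsTrajectory

theorem mul_mem_attainable {ε : ℝ} {p r : Heis} (g : Heis) (h : r ∈ attainable ε p) :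
    g * r ∈ attainable ε (g * p) := by
  obtain ⟨t, ht, q, u, hq, rfl, rfl⟩ := h
  exact ⟨t, ht, _, u, hq.mul_left g, rfl, rfl⟩

theorem mem_attainable_iff {ε : ℝ} {p r : Heis} :
    r ∈ attainable ε p ↔ p⁻¹ * r ∈ attainable ε 1 :=
  ⟨fun h => by simpa using mul_mem_attainable p⁻¹ h, fun h => by simpa using mul_mem_attainable p h⟩

/-- Reaching `r` from `p` backwards in time is the same as reaching `p` from `r`. -/
theorem mem_attainableNeg_iff {ε : ℝ} {p r : Heis} :
    r ∈ attainableNeg ε p ↔ p ∈ attainable ε r := by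
  constructor
  · rintro ⟨t, ht, q, u, hq, h0, ht'⟩
    refine ⟨-t, neg_nonneg.2 ht, fun s => q (s - -t), fun s => u (s - -t), ?_, ?_, ?_⟩
    · simpa using hq.comp_sub_const (-t)
    · simpa using ht'
    · simpa using h0
  · rintro ⟨t, ht, q, u, hq, h0, ht'⟩
    refine ⟨-t, neg_nonpos.2 ht, fun s => q (s - -t), fun s => u (s - -t), ?_, ?_, ?_⟩
    · simpa using hq.comp_sub_const (-t)
    · simpa using ht'
    · simpa using h0

end Heis

theorem mainTheorem1 (ε : ℝ) (hε : 0 < ε) :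
    Heis.attainable ε 1 = Heis.domainD ε ∧
    Heis.attainableNeg ε 1 =
      {q : Heis | q.x ≤ -|q.y| ∧
        |q.z| ≤ ε ^ 2 / 2 * (Real.sinh (Heis.tau ε q.x q.y) + Heis.tau ε q.x q.y)} ∧
    ∀ q₁ : Heis,
      (Heis.attainable ε q₁ = (fun q => q₁ * q) '' Heis.attainable ε 1 ∧
        Heis.attainable ε q₁ =
          {q : Heis | |q.y - q₁.y| ≤ q.x - q₁.x ∧
            |q.z - q₁.z - (q₁.x * q.y - q.x * q₁.y) / 2| ≤
              ε ^ 2 / 2 * (Real.sinh (Heis.tau ε (q.x - q₁.x) (q.y - q₁.y)) +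
                Heis.tau ε (q.x - q₁.x) (q.y - q₁.y))}) ∧
      (Heis.attainableNeg ε q₁ = (fun q => q₁ * q) '' Heis.attainableNeg ε 1 ∧
        Heis.attainableNeg ε q₁ =
          {q : Heis | q.x - q₁.x ≤ -|q.y - q₁.y| ∧
            |q.z - q₁.z - (q₁.x * q.y - q.x * q₁.y) / 2| ≤
              ε ^ 2 / 2 * (Real.sinh (Heis.tau ε (q.x - q₁.x) (q.y - q₁.y)) +
                Heis.tau ε (q.x - q₁.x) (q.y - q₁.y))}) := by
  have hD : Heis.attainable ε 1 = Heis.domainD ε :=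
    (Heis.attainable_one_subset hε).antisymm (Heis.domainD_subset hε)
  have hneg : ∀ p r : Heis, r ∈ Heis.attainableNeg ε p ↔ r⁻¹ * p ∈ Heis.domainD ε := fun p r => by
    rw [Heis.mem_attainableNeg_iff, Heis.mem_attainable_iff, hD]
  have hτ : ∀ x y, Heis.tau ε (-x) (-y) = Heis.tau ε x y := fun x y => by simp [Heis.tau]
  refine ⟨hD, ?_, fun q₁ => ⟨⟨?_, ?_⟩, ?_, ?_⟩⟩
  · ext q
    rw [hneg]
    simp [Heis.domainD, hτ, le_neg]
  · ext q
    rw [Heis.mem_attainable_iff, image_mul_left, mem_preimage]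
  · ext q
    rw [Heis.mem_attainable_iff, hD]
    simp only [Heis.domainD, mem_ofPred_eq, Heis.mul_x, Heis.mul_y, Heis.mul_z, Heis.inv_x,
      Heis.inv_y, Heis.inv_z]
    ring_nf
  · ext q
    rw [image_mul_left, mem_preimage, hneg, hneg, mul_inv_rev, inv_inv, mul_one]
  · ext q
    rw [hneg]
    -- The coordinates of `q⁻¹ * q₁` are the negatives of those of `q₁⁻¹ * q`; `tau` and the height
    -- condition are even, and only the cone condition flips.
    have e1 : -q.x + q₁.x = -(q.x - q₁.x) := by ring
    have e2 : -q.y + q₁.y = -(q.y - q₁.y) := by ring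
    have e3 : -q.z + q₁.z + (-q.x * q₁.y - q₁.x * -q.y) / 2 =
      -(q.z - q₁.z - (q₁.x * q.y - q.x * q₁.y) / 2) := by ring
    simp only [Heis.domainD, mem_ofPred_eq, Heis.mul_x, Heis.mul_y, Heis.mul_z, Heis.inv_x,
      Heis.inv_y, Heis.inv_z]
    rw [e1, e2, e3, hτ, abs_neg, abs_neg, le_neg]
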